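/- Let $n$ be a positive integer and let $G$ be a finite group of order $m$. For an integer $N \ge 0$ let $Q_N(G)$ be the Dowling lattice of rank $N$: its elements are the classes of partial $G$-partitions of $X=\{x_1,\dots,x_N\}$, that is, of collections $\mathcal F=\{\alpha_1,\dots,\alpha_r\}$ of functions $\alpha_i\colon A_i\to G$ whose domains are non-empty pairwise disjoint subsets of $X$. One puts $\mathcal F\le\mathcal G$ if for every $\beta\colon B\to G$ in $\mathcal G$ the set $B$ is a union of domains $A_i$ of members of $\mathcal F$ such that $\beta|_{A_i}=\lambda_i\alpha_i$ for some $\lambda_i\in G$; two collections are identified when $\mathcal F\le\mathcal G\le\mathcal F$. The least element $\hat 0$ is the class of $\{e_1,\dots,e_N\}$ with $e_i\colon\{x_i\}\to G$, $e_i(x_i)=1$, and the rank is $r(\mathcal F)=N-|\mathcal F|$. Let $\mu$ be the Möbius function of $Q_N(G)$ and let $$w_m(N,k)=\sum_{x\in Q_N(G),\ r(x)=N-k}\mu(\hat 0,x),\qquad W_m(N,k)=\sum_{x\in Q_N(G),\ r(x)=N-k}1$$ be the Whitney numbers of $Q_N(G)$ of the first and of the second kind. For non-negative integers $s,t$ put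 $$c_{n,t}(s)=\sum_{k\ge 0}w_m(n,k)\,W_m(k+s,t),$$ a finite sum because $w_m(n,k)=0$ for $k>n$. Let $t\ge 0$ be an integer. 1. If $t<n$, then $c_{n,t}(s)=0$ for every $s\ge 0$. 2. If $t\ge n$, then, as formal Laurent series over $\mathbb Q$, $$\sum_{s\ge 0}c_{n,t}(s)\,x^s=\frac1x\prod_{j=n}^{t}\frac{x}{1-(1+jm)x}.$$ 3. In particular, $\sum_{k\ge 0}w_m(n,k)\,W_m(k,t)=\delta(n,t)$, where $\delta(n,t)=1$ if $n=t$ and $\delta(n,t)=0$ otherwise. -/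

import Mathlib

namespace Dowling

/-- The domain of a partial function `α : X ⇀ G`, encoded as a map `X → Option G`. -/
def dom {X G : Type*} (α : X → Option G) : Set X := {x | ∃ g, α x = some g}

/-- A partial `G`-partition of `X = Fin n`: a collection of functions `α : A → G` (the blocks)
whose domains are nonempty, pairwise disjoint subsets of `X`. -/
structure PartialGPartition (n : ℕ) (G : Type*) where
  blocks : Finset (Fin n → Option G)
  nonempty : ∀ α ∈ blocks, (dom α).Nonempty
  disjoint : ∀ α ∈ blocks, ∀ β ∈ blocks, α ≠ β → Disjoint (dom α) (dom β)

/-- `β` is a `G`-linear combination of the functions in `M`: the domain of `β` is the union of the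
domains of the members of `M`, and for each `α ∈ M` the restriction of `β` to the domain of `α` is
a left scalar multiple `c • α`, with `c ∈ G`. -/
def IsLinComb {X G : Type*} [Mul G] (β : X → Option G) (M : Set (X → Option G)) : Prop :=
  dom β = ⋃ α ∈ M, dom α ∧
    ∀ α ∈ M, ∃ c : G, ∀ x g, α x = some g → β x = some (c * g)

variable {n : ℕ} {G : Type*}

/-- `P ≤ Q` if every block of `Q` is a `G`-linear combination of blocks of `P` (in particular its
domain is a union of domains of blocks of `P`). -/
instance [Group G] : Preorder (PartialGPartition n G) where
  le P Q := ∀ β ∈ Q.blocks, ∃ M : Set (Fin n → Option G), M ⊆ ↑P.blocks ∧ IsLinComb β M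
  le_refl P := by
    intro β hβ
    refine ⟨{β}, by simpa using hβ, by simp, ?_⟩
    rintro α rfl
    exact ⟨1, fun x g h => by simpa using h⟩
  le_trans P Q R hPQ hQR := by
    intro γ hγ
    obtain ⟨M, hM, hdom, hlin⟩ := hQR γ hγ
    choose! N hN hNdom hNlin using hPQ
    refine ⟨⋃ β ∈ M, N β, ?_, ?_, ?_⟩
    · exact Set.iUnion₂_subset fun β hβ => hN β (hM hβ)
    · rw [hdom, Set.biUnion_iUnion]
      refine Set.iUnion_congr fun β => ?_
      rw [Set.biUnion_iUnion]
      exact Set.iUnion_congr fun hβ => hNdom β (hM hβ)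
    · intro α hα
      obtain ⟨β, hβ, hα⟩ := Set.mem_iUnion₂.1 hα
      obtain ⟨c, hc⟩ := hlin β hβ
      obtain ⟨d, hd⟩ := hNlin β (hM hβ) α hα
      exact ⟨c * d, fun x g h => by rw [hc x _ (hd x g h), mul_assoc]⟩

theorem PartialGPartition.card_le_of_le [Group G] {P Q : PartialGPartition n G} (h : P ≤ Q) :
    Q.blocks.card ≤ P.blocks.card := by
  have key : ∀ β ∈ Q.blocks, ∃ α ∈ P.blocks, dom α ⊆ dom β := by
    intro β hβ
    obtain ⟨M, hM, hdom, -⟩ := h β hβ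
    obtain ⟨x, hx⟩ := Q.nonempty β hβ
    rw [hdom] at hx
    obtain ⟨α, hα, -⟩ := Set.mem_iUnion₂.1 hx
    exact ⟨α, hM hα, hdom ▸ Set.subset_biUnion_of_mem (u := fun α => dom α) hα⟩
  choose! f hf hsub using key
  refine Finset.card_le_card_of_injOn f (fun β hβ => hf β hβ) fun β hβ γ hγ hfe => ?_
  by_contra hne
  obtain ⟨x, hx⟩ := P.nonempty _ (hf β hβ)
  exact Set.disjoint_left.1 (Q.disjoint β hβ γ hγ hne) (hsub β hβ hx) (hsub γ hγ (hfe ▸ hx))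

theorem PartialGPartition.card_le (P : PartialGPartition n G) : P.blocks.card ≤ n := by
  have h := P.nonempty
  rcases n with _ | n
  · rw [Finset.card_eq_zero.2]
    exact Finset.eq_empty_of_forall_notMem fun α hα => (h α hα).choose.elim0
  · choose! f hf using h
    have := Finset.card_le_card_of_injOn (s := P.blocks) (t := Finset.univ) f
      (fun _ _ => Finset.mem_coe.2 (Finset.mem_univ _)) fun β hβ γ hγ hfe => by
        by_contra hne
        exact Set.disjoint_left.1 (P.disjoint β hβ γ hγ hne) (hf β hβ) (hfe ▸ hf γ hγ)
    simpa using this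

instance [Finite G] : Finite (PartialGPartition n G) :=
  Finite.of_injective PartialGPartition.blocks fun P Q h => by
    cases P; cases Q; cases h; rfl

/-- The Dowling lattice `Q_n(G)`: partial `G`-partitions modulo the equivalence
`P ≤ Q ∧ Q ≤ P`, with the induced partial order. -/
abbrev DowlingLattice (n : ℕ) (G : Type*) [Group G] : Type _ :=
  Antisymmetrization (PartialGPartition n G) (· ≤ ·)

/-- The rank function `r(F) = n - |F|` on `Q_n(G)`, where `|F|` is the number of blocks. -/
def rank [Group G] : DowlingLattice n G → ℤ :=
  Quotient.lift (fun P : PartialGPartition n G => (n : ℤ) - P.blocks.card) fun P Q h => by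
    have h1 := PartialGPartition.card_le_of_le (show P ≤ Q from h.1)
    have h2 := PartialGPartition.card_le_of_le (show Q ≤ P from h.2)
    have h3 : P.blocks.card = Q.blocks.card := le_antisymm h2 h1
    simp only [h3]

/-- The function `e_i : {x_i} → G`, `e_i(x_i) = 1`. -/
def unitBlock (n : ℕ) (G : Type*) [Group G] (i : Fin n) : Fin n → Option G :=
  fun x => if x = i then some 1 else none

theorem dom_unitBlock [Group G] (i : Fin n) : dom (unitBlock n G i) = {i} := by
  ext x
  by_cases h : x = i <;> simp [dom, unitBlock, h]

open Classical in
/-- The partial `G`-partition `{e_1, …, e_n}`. -/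
noncomputable def zeroPartition (n : ℕ) (G : Type*) [Group G] : PartialGPartition n G where
  blocks := Finset.univ.image (unitBlock n G)
  nonempty := by simp [dom_unitBlock]
  disjoint := by
    simp only [Finset.mem_image, Finset.mem_univ, true_and, forall_exists_index,
      forall_apply_eq_imp_iff, dom_unitBlock, Set.disjoint_singleton]
    intro i j h hij
    exact h (hij ▸ rfl)

/-- The least element of `Q_n(G)` is the class of `{e_1, …, e_n}`. -/
noncomputable instance [Group G] : OrderBot (DowlingLattice n G) where
  bot := toAntisymmetrization (· ≤ ·) (zeroPartition n G)
  bot_le := by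
    intro q
    induction q using Quotient.inductionOn with
    | h Q =>
      change zeroPartition n G ≤ Q
      intro β hβ
      refine ⟨unitBlock n G '' dom β, ?_, ?_, ?_⟩
      · rintro _ ⟨i, -, rfl⟩
        simp [zeroPartition]
      · simp [dom_unitBlock]
      · rintro _ ⟨i, ⟨g, hg⟩, rfl⟩
        refine ⟨g, fun x a hx => ?_⟩
        by_cases h : x = i
        · subst h
          have : a = 1 := by simpa [unitBlock, eq_comm] using hx
          simpa [this] using hg
        · simp [unitBlock, h] at hx

noncomputable instance [Group G] [Finite G] : Fintype (DowlingLattice n G) := by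
  haveI : Finite (DowlingLattice n G) := Quotient.finite _
  exact Fintype.ofFinite _

noncomputable instance [Group G] : DecidableEq (DowlingLattice n G) := Classical.decEq _

open Classical in
noncomputable instance [Group G] [Finite G] : LocallyFiniteOrder (DowlingLattice n G) :=
  Fintype.toLocallyFiniteOrder

variable (G) [Group G] [Finite G]

/-- Whitney numbers of the first kind of `Q_n(G)`: the sum of `μ(0̂, x)` over all `x` of rank
`n - k`. -/
noncomputable def whitneyFirst (n k : ℕ) : ℤ :=
  ∑ x : DowlingLattice n G with rank x = (n : ℤ) - k, IncidenceAlgebra.mu ℤ ⊥ x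

/-- Whitney numbers of the second kind of `Q_n(G)`: the number of `x` of rank `n - k`. -/
noncomputable def whitneySecond (n k : ℕ) : ℤ :=
  ∑ _x : DowlingLattice n G with rank _x = (n : ℤ) - k, 1

/-- The shifted convolution `c_{n,t}(s) = ∑_{k ≥ 0} w(n,k) W(k+s,t)`. The sum has finite support,
see `whitneyFirst_eq_zero`. -/
noncomputable def shiftedConvolution (n t s : ℕ) : ℤ :=
  ∑ᶠ k : ℕ, whitneyFirst G n k * whitneySecond G (k + s) t

theorem whitneyFirst_eq_zero {n k : ℕ} (h : n < k) : whitneyFirst G n k = 0 := by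
  refine Finset.sum_eq_zero fun x hx => ?_
  exfalso
  induction x using Quotient.inductionOn with
  | h P =>
    have h1 : (n : ℤ) - P.blocks.card = n - k := (Finset.mem_filter.1 hx).2
    have h2 := P.card_le
    omega

/-- The sums over all `k ≥ 0` are genuine finite sums over `0 ≤ k ≤ n`. -/
theorem finsum_whitneyFirst_mul (n : ℕ) (f : ℕ → ℤ) :
    ∑ᶠ k : ℕ, whitneyFirst G n k * f k = ∑ k ∈ Finset.range (n + 1), whitneyFirst G n k * f k := by
  refine finsum_eq_sum_of_support_subset _ fun k hk => ?_
  by_contra hk'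
  refine hk ?_
  have : n < k := by simpa using hk'
  simp [whitneyFirst_eq_zero G this]

end Dowling

/-!
Let `m` be the order of `G`, let `J` be a set of `y` labels, and consider the partial functions from
`{x_1, …, x_n}` to `J × G`. The points where such a function takes the label `j ∈ J` carry a
`G`-valued function, and these functions for all `j` form a partial `G`-partition, the kernel
`ker f`. Given a partial `G`-partition `P` with `k` blocks, the functions with `P ≤ ker f` correspond
to arbitrary assignments of a value in `J × G`, or of no value, to each block, so there are
`(1 + m y) ^ k` of them (`card_le_ker`). The kernel is equivalent to `P` exactly when all blocks get
a value and the labels are distinct, which leaves `∏ i < k, (m y - m i)` functions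
(`card_antisymmRel_ker`). Sorting the functions of the first kind by their kernels gives, for every
element `x` of the Dowling lattice and every natural number `y`,
`∑ z ≥ x, ∏ i < |z|, (m y - m i) = (1 + m y) ^ |x|`
where `|z|` is the number of blocks (`sum_scaledDescFactorial_numBlocks`).

The products on the left are linearly independent, so this identity determines the number of
`z ≥ x` with `t` blocks. It has two consequences. That number depends only on `|x|`, so it is
`W(|x|, t)`; summing the Möbius function over intervals then shows that the matrices `w` and `W` are
inverse to each other (`finsum_whitneyFirst_mul_whitneySecond`). Multiplying the identity for `x = ⊥`
by `1 + m y` gives the recurrence `W(n + 1, t) = W(n, t - 1) + (1 + t m) W(n, t)`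
(`whitneySecond_succ`).

The recurrence passes to `c_{n,t}(s + 1) = c_{n,t-1}(s) + (1 + t m) c_{n,t}(s)`, and the inversion
gives the initial values `c_{n,t}(0) = δ(n, t)`. The vanishing for `t < n` follows by induction on
`s`. For `t ≥ n` the generating functions satisfy `(1 - (1 + t m) x) C_t = x C_{t-1} + δ(n, t)`,
and the product formula follows by induction on `t`.
-/

namespace Dowling

/-! ### Kernels of labelled partial functions -/

section Kernel

variable {n : ℕ} {G J : Type*}

/-- Pointwise form of the order relation: a function is a combination of blocks of `P` exactly when
every point of its domain lies in a block of `P` on which it is a left multiple of that block. -/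
theorem PartialGPartition.exists_isLinComb_iff [Mul G] (P : PartialGPartition n G)
    (β : Fin n → Option G) :
    (∃ M : Set (Fin n → Option G), M ⊆ ↑P.blocks ∧ IsLinComb β M) ↔
      ∀ x ∈ dom β, ∃ α ∈ P.blocks, x ∈ dom α ∧
        ∃ c : G, ∀ y g, α y = some g → β y = some (c * g) := by
  constructor
  · rintro ⟨M, hM, hdom, hlin⟩ x hx
    rw [hdom] at hx
    obtain ⟨α, hα, hxα⟩ := Set.mem_iUnion₂.1 hx
    exact ⟨α, hM hα, hxα, hlin α hα⟩
  · intro h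
    refine ⟨{α | α ∈ P.blocks ∧ ∃ c : G, ∀ y g, α y = some g → β y = some (c * g)},
      fun α hα => hα.1, Set.Subset.antisymm ?_ ?_, fun α hα => hα.2⟩
    · intro x hx
      obtain ⟨α, hα, hxα, hc⟩ := h x hx
      exact Set.mem_iUnion₂.2 ⟨α, ⟨hα, hc⟩, hxα⟩
    · refine Set.iUnion₂_subset fun α hα x hx => ?_
      obtain ⟨g, hg⟩ := hx
      obtain ⟨c, hc⟩ := hα.2
      exact ⟨_, hc x g hg⟩

theorem PartialGPartition.eq_of_mem_dom (P : PartialGPartition n G) {α β : Fin n → Option G}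
    (hα : α ∈ P.blocks) (hβ : β ∈ P.blocks) {x : Fin n} (hxα : x ∈ dom α) (hxβ : x ∈ dom β) :
    α = β := by
  by_contra h
  exact Set.disjoint_left.1 (P.disjoint α hα β hβ h) hxα hxβ

open Classical in
/-- The part with label `j` of a `J × G`-valued partial function: it sends `x` to `g` when
`f x = (j, g)` and is undefined elsewhere. -/
noncomputable def part (f : Fin n → Option (J × G)) (j : J) : Fin n → Option G :=
  fun x => (f x).bind fun p => if p.1 = j then some p.2 else none

theorem part_eq_some_iff {f : Fin n → Option (J × G)} {j : J} {x : Fin n} {g : G} :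
    part f j x = some g ↔ f x = some (j, g) := by
  unfold part
  rcases f x with _ | ⟨i, h⟩
  · simp
  · by_cases hij : i = j <;> simp [hij]

open Classical in
/-- The kernel of a `J × G`-valued partial function: the partial `G`-partition formed by its
nonempty parts. -/
noncomputable def ker [Fintype J] (f : Fin n → Option (J × G)) : PartialGPartition n G where
  blocks := (Finset.univ.image (part f)).filter fun α => (dom α).Nonempty
  nonempty α hα := (Finset.mem_filter.1 hα).2
  disjoint α hα β hβ hne := by
    obtain ⟨i, -, rfl⟩ := Finset.mem_image.1 (Finset.mem_filter.1 hα).1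
    obtain ⟨j, -, rfl⟩ := Finset.mem_image.1 (Finset.mem_filter.1 hβ).1
    refine Set.disjoint_left.2 ?_
    rintro x ⟨g, hg⟩ ⟨h, hh⟩
    rw [part_eq_some_iff] at hg hh
    rw [hg] at hh
    simp only [Option.some.injEq, Prod.mk.injEq] at hh
    exact hne (by rw [hh.1])

theorem mem_ker_blocks [Fintype J] {f : Fin n → Option (J × G)} {α : Fin n → Option G} :
    α ∈ (ker f).blocks ↔ (∃ j, part f j = α) ∧ (dom α).Nonempty := by
  simp [ker]

variable [Group G]

theorem le_ker_iff [Fintype J] (P : PartialGPartition n G) (f : Fin n → Option (J × G)) :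
    P ≤ ker f ↔ ∀ x j h, f x = some (j, h) → ∃ α ∈ P.blocks, x ∈ dom α ∧
      ∃ c : G, ∀ y g, α y = some g → f y = some (j, c * g) := by
  have h1 : P ≤ ker f ↔ ∀ β ∈ (ker f).blocks,
      ∃ M : Set (Fin n → Option G), M ⊆ ↑P.blocks ∧ IsLinComb β M := Iff.rfl
  simp only [h1, P.exists_isLinComb_iff, mem_ker_blocks]
  constructor
  · intro H x j h hx
    have hxd : x ∈ dom (part f j) := ⟨h, part_eq_some_iff.2 hx⟩
    simpa only [part_eq_some_iff] using H _ ⟨⟨j, rfl⟩, x, hxd⟩ x hxd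
  · rintro H _ ⟨⟨j, rfl⟩, -⟩ x ⟨h, hx⟩
    simpa only [part_eq_some_iff] using H x j h (part_eq_some_iff.1 hx)

theorem ker_le_iff [Fintype J] (P : PartialGPartition n G) (f : Fin n → Option (J × G)) :
    ker f ≤ P ↔ ∀ α ∈ P.blocks, ∀ x ∈ dom α, ∃ j h, f x = some (j, h) ∧
      ∃ c : G, ∀ y g, f y = some (j, g) → α y = some (c * g) := by
  have h1 : ker f ≤ P ↔ ∀ β ∈ P.blocks,
      ∃ M : Set (Fin n → Option G), M ⊆ ↑(ker f).blocks ∧ IsLinComb β M := Iff.rfl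
  simp only [h1, (ker f).exists_isLinComb_iff, mem_ker_blocks]
  refine forall₂_congr fun α _ => forall₂_congr fun x _ => ⟨?_, ?_⟩
  · rintro ⟨_, ⟨⟨j, rfl⟩, -⟩, ⟨h, hx⟩, H⟩
    exact ⟨j, h, part_eq_some_iff.1 hx, by simpa only [part_eq_some_iff] using H⟩
  · rintro ⟨j, h, hx, H⟩
    have hxd : x ∈ dom (part f j) := ⟨h, part_eq_some_iff.2 hx⟩
    exact ⟨part f j, ⟨⟨j, rfl⟩, x, hxd⟩, hxd, by simpa only [part_eq_some_iff] using H⟩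

open Classical in
/-- The `J × G`-valued partial function obtained from labels `φ α = (j, c)` of the blocks `α` of
`P`: it is `(j, c • α)` on `dom α`, and undefined on blocks without a label and outside all blocks.
-/
noncomputable def extend (P : PartialGPartition n G) (φ : P.blocks → Option (J × G)) :
    Fin n → Option (J × G) := fun x =>
  if h : ∃ α : P.blocks, x ∈ dom α.1 then
    (φ h.choose).map fun p => (p.1, p.2 * h.choose_spec.choose)
  else none

theorem extend_apply (P : PartialGPartition n G) (φ : P.blocks → Option (J × G)) (α : P.blocks)
    {x : Fin n} {g : G} (hx : α.1 x = some g) :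
    extend P φ x = (φ α).map fun p => (p.1, p.2 * g) := by
  have h : ∃ α : P.blocks, x ∈ dom α.1 := ⟨α, g, hx⟩
  have hα : h.choose = α :=
    Subtype.ext (P.eq_of_mem_dom h.choose.2 α.2 h.choose_spec ⟨g, hx⟩)
  have hg : h.choose_spec.choose = g := by
    have h2 : ∀ (β : P.blocks) (k : G), β = α → β.1 x = some k → k = g := by
      rintro β k rfl hk
      exact Option.some.inj (hk.symm.trans hx)
    exact h2 _ _ hα h.choose_spec.choose_spec
  unfold extend
  rw [dif_pos h, hg, hα]

theorem extend_eq_some (P : PartialGPartition n G) {φ : P.blocks → Option (J × G)} {x : Fin n}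
    {j : J} {h : G} (hx : extend P φ x = some (j, h)) :
    ∃ (α : P.blocks) (g c : G), α.1 x = some g ∧ φ α = some (j, c) ∧ h = c * g := by
  by_cases hex : ∃ α : P.blocks, x ∈ dom α.1
  · obtain ⟨α, g, hg⟩ := hex
    rw [extend_apply P φ α hg] at hx
    obtain ⟨⟨i, c⟩, hφ, hp⟩ := Option.map_eq_some_iff.1 hx
    simp only [Prod.mk.injEq] at hp
    exact ⟨α, g, c, hg, by rw [hφ, hp.1], hp.2.symm⟩
  · simp [extend, dif_neg hex] at hx

theorem extend_injective (P : PartialGPartition n G) :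
    Function.Injective (extend P : (P.blocks → Option (J × G)) → _) := by
  intro φ ψ h
  funext α
  obtain ⟨x, g, hg⟩ := P.nonempty α.1 α.2
  have hx := congrFun h x
  rw [extend_apply P φ α hg, extend_apply P ψ α hg] at hx
  refine Option.map_injective ?_ hx
  rintro ⟨i, c⟩ ⟨j, d⟩ hp
  simpa using hp

theorem le_ker_iff_exists_extend [Fintype J] (P : PartialGPartition n G)
    (f : Fin n → Option (J × G)) : P ≤ ker f ↔ ∃ φ, extend P φ = f := by
  rw [le_ker_iff]
  constructor
  · intro H
    choose a ha using fun α : P.blocks => P.nonempty α.1 α.2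
    choose b hb using ha
    -- the label of a block is read off at an arbitrary point of it
    refine ⟨fun α => (f (a α)).map fun p => (p.1, p.2 * (b α)⁻¹), funext fun x => ?_⟩
    by_cases hex : ∃ α : P.blocks, x ∈ dom α.1
    · obtain ⟨α, g, hg⟩ := hex
      rw [extend_apply P _ α hg]
      have key : ∀ {y z : Fin n} {k l : G}, α.1 y = some k → α.1 z = some l → ∀ {j h},
          f y = some (j, h) → f z = some (j, h * k⁻¹ * l) := by
        intro y z k l hy hz j h hf
        obtain ⟨α', hα', hyα', c, hc⟩ := H y j h hf
        obtain rfl := P.eq_of_mem_dom hα' α.2 hyα' ⟨k, hy⟩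
        have h1 := hc y k hy
        rw [hf] at h1
        simp only [Option.some.injEq, Prod.mk.injEq, true_and] at h1
        rw [hc z l hz, h1]
        simp
      rcases hfa : f (a α) with _ | ⟨j, h⟩
      · rcases hfx : f x with _ | ⟨j, h⟩
        · simp
        · rw [key hg (hb α) hfx] at hfa
          simp at hfa
      · simp [key (hb α) hg hfa]
    · rw [extend, dif_neg hex]
      rcases hfx : f x with _ | ⟨j, h⟩
      · rfl
      · obtain ⟨α, hα, hxα, -⟩ := H x j h hfx
        exact absurd ⟨⟨α, hα⟩, hxα⟩ hex
  · rintro ⟨φ, rfl⟩ x j h hx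
    obtain ⟨α, g, c, hg, hφ, rfl⟩ := extend_eq_some P hx
    refine ⟨α.1, α.2, ⟨g, hg⟩, c, fun y k hy => ?_⟩
    rw [extend_apply P φ α hy, hφ]
    rfl

/-- The kernel of an extension is equivalent to `P` exactly when all blocks of `P` are labelled, and
by distinct elements of `J`. -/
theorem ker_extend_le_iff [Fintype J] (P : PartialGPartition n G)
    (φ : P.blocks → Option (J × G)) :
    ker (extend P φ) ≤ P ↔
      ∃ (e : P.blocks ↪ J) (c : P.blocks → G), (fun α => some (e α, c α)) = φ := by
  rw [ker_le_iff]
  constructor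
  · intro H
    have hsome : ∀ α : P.blocks, ∃ p : J × G, φ α = some p := by
      intro α
      obtain ⟨x, g, hg⟩ := P.nonempty α.1 α.2
      obtain ⟨j, h, hx, -⟩ := H α.1 α.2 x ⟨g, hg⟩
      rw [extend_apply P φ α hg] at hx
      obtain ⟨p, hp, -⟩ := Option.map_eq_some_iff.1 hx
      exact ⟨p, hp⟩
    choose p hp using hsome
    refine ⟨⟨fun α => (p α).1, fun α β hαβ => Subtype.ext ?_⟩, fun α => (p α).2,
      funext fun α => (hp α).symm⟩
    obtain ⟨x, g, hg⟩ := P.nonempty α.1 α.2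
    obtain ⟨y, k, hk⟩ := P.nonempty β.1 β.2
    obtain ⟨j, h, hx, c, hc⟩ := H α.1 α.2 x ⟨g, hg⟩
    rw [extend_apply P φ α hg, hp α] at hx
    simp only [Option.map_some, Option.some.injEq, Prod.mk.injEq] at hx
    have hy : extend P φ y = some (j, (p β).2 * k) := by
      rw [extend_apply P φ β hk, hp β, ← hx.1]
      simpa using hαβ.symm
    exact P.eq_of_mem_dom α.2 β.2 ⟨_, hc y _ hy⟩ ⟨k, hk⟩
  · rintro ⟨e, c, rfl⟩ α hα x ⟨g, hg⟩
    refine ⟨e ⟨α, hα⟩, c ⟨α, hα⟩ * g, by rw [extend_apply P _ ⟨α, hα⟩ hg]; rfl,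
      (c ⟨α, hα⟩)⁻¹, fun y h hy => ?_⟩
    obtain ⟨β, k, d, hk, hβ, rfl⟩ := extend_eq_some P hy
    simp only [Option.some.injEq, Prod.mk.injEq, EmbeddingLike.apply_eq_iff_eq] at hβ
    obtain ⟨rfl, rfl⟩ := hβ
    simpa using hk

theorem card_le_ker [Fintype J] [Finite G] (P : PartialGPartition n G) :
    Nat.card {f : Fin n → Option (J × G) // P ≤ ker f} =
      (1 + Nat.card G * Fintype.card J) ^ P.blocks.card := by
  have e : {f : Fin n → Option (J × G) // P ≤ ker f} ≃ (P.blocks → Option (J × G)) :=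
    ((Equiv.ofInjective _ (extend_injective P)).trans
      (Equiv.subtypeEquivRight fun f => (le_ker_iff_exists_extend P f).symm)).symm
  have := Fintype.ofFinite G
  classical
  rw [Nat.card_congr e, Nat.card_eq_fintype_card, Nat.card_eq_fintype_card]
  simp [mul_comm, add_comm]

theorem card_antisymmRel_ker [Fintype J] [Finite G] (P : PartialGPartition n G) :
    Nat.card {f : Fin n → Option (J × G) // P ≤ ker f ∧ ker f ≤ P} =
      Nat.card G ^ P.blocks.card * (Fintype.card J).descFactorial P.blocks.card := by
  have := Fintype.ofFinite G
  let F : (P.blocks ↪ J) × (P.blocks → G) → Fin n → Option (J × G) :=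
    fun q => extend P fun α => some (q.1 α, q.2 α)
  have hF : Function.Injective F := by
    rintro ⟨e, c⟩ ⟨e', c'⟩ h
    have h' := extend_injective P h
    have h2 : ∀ α, e α = e' α ∧ c α = c' α := fun α => by simpa using congrFun h' α
    exact Prod.ext (DFunLike.ext _ _ fun α => (h2 α).1) (funext fun α => (h2 α).2)
  have hrange : ∀ f, f ∈ Set.range F ↔ P ≤ ker f ∧ ker f ≤ P := by
    intro f
    constructor
    · rintro ⟨q, rfl⟩
      exact ⟨(le_ker_iff_exists_extend P _).2 ⟨_, rfl⟩,
        (ker_extend_le_iff P _).2 ⟨q.1, q.2, rfl⟩⟩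
    · rintro ⟨h1, h2⟩
      obtain ⟨φ, rfl⟩ := (le_ker_iff_exists_extend P f).1 h1
      obtain ⟨e, c, rfl⟩ := (ker_extend_le_iff P φ).1 h2
      exact ⟨(e, c), rfl⟩
  rw [← Nat.card_congr ((Equiv.ofInjective F hF).trans (Equiv.subtypeEquivRight hrange))]
  classical
  simp [Nat.card_eq_fintype_card, Fintype.card_embedding_eq, mul_comm]

end Kernel

/-! ### Counting elements above a given one -/

section Counting

variable {n : ℕ} {G : Type*} [Group G]

/-- The number of blocks of an element of the Dowling lattice. -/
def numBlocks : DowlingLattice n G → ℕ :=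
  Quotient.lift (fun P : PartialGPartition n G => P.blocks.card) fun P Q h =>
    le_antisymm (PartialGPartition.card_le_of_le (show Q ≤ P from h.2))
      (PartialGPartition.card_le_of_le (show P ≤ Q from h.1))

theorem rank_eq_iff (x : DowlingLattice n G) (k : ℕ) :
    rank x = (n : ℤ) - k ↔ numBlocks x = k := by
  have h : rank x = (n : ℤ) - numBlocks x := by
    induction x using Quotient.inductionOn with
    | h P => rfl
  omega

theorem numBlocks_le (x : DowlingLattice n G) : numBlocks x ≤ n := by
  induction x using Quotient.inductionOn with
  | h P => exact P.card_le

theorem numBlocks_bot : numBlocks (⊥ : DowlingLattice n G) = n := by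
  change (zeroPartition n G).blocks.card = n
  classical
  have hinj : Function.Injective (unitBlock n G) := fun i j h => by
    simpa [dom_unitBlock] using congrArg dom h
  simp only [zeroPartition]
  convert Finset.card_image_of_injective Finset.univ hinj
  simp

/-- The product `∏ i < t, (m * y - m * i)`, written as `m ^ t` times a falling factorial of `y`; both
vanish for `y < t`. With `m = |G|` it counts the partial functions to `{1, …, y} × G` with a given
kernel of `t` blocks. -/
def scaledDescFactorial (m t y : ℕ) : ℤ := (m : ℤ) ^ t * (y.descFactorial t : ℤ)

theorem scaledDescFactorial_succ (m t y : ℕ) :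
    scaledDescFactorial m (t + 1) y = ((m : ℤ) * y - m * t) * scaledDescFactorial m t y := by
  unfold scaledDescFactorial
  rw [Nat.descFactorial_succ]
  rcases le_or_gt t y with h | h
  · push_cast [Nat.cast_sub h]
    ring
  · simp [Nat.descFactorial_of_lt h]

theorem eq_of_sum_mul_scaledDescFactorial_eq {m K : ℕ} (hm : 0 < m) {a b : ℕ → ℤ}
    (h : ∀ y, ∑ t ∈ Finset.range K, a t * scaledDescFactorial m t y =
      ∑ t ∈ Finset.range K, b t * scaledDescFactorial m t y) {t : ℕ} (ht : t < K) :
    a t = b t := by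
  induction t using Nat.strong_induction_on with
  | _ t ih =>
    -- at `y = t` the terms beyond `t` vanish
    have h0 : ∑ i ∈ Finset.range K, (a i - b i) * scaledDescFactorial m i t = 0 := by
      simp only [sub_mul, Finset.sum_sub_distrib, h t, sub_self]
    rw [Finset.sum_eq_single_of_mem t (Finset.mem_range.2 ht)] at h0
    · have hne : scaledDescFactorial m t t ≠ 0 := by
        simp [scaledDescFactorial, Nat.descFactorial_self, hm.ne', Nat.factorial_ne_zero]
      exact sub_eq_zero.1 ((mul_eq_zero.1 h0).resolve_right hne)
    · intro i hi hit
      rcases lt_or_gt_of_ne hit with hlt | hgt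
      · rw [ih i hlt (Finset.mem_range.1 hi), sub_self, zero_mul]
      · simp [scaledDescFactorial, Nat.descFactorial_of_lt hgt]

variable [Finite G]

open Classical in
/-- Both sides count the partial functions to `{1, …, y} × G` whose kernel lies above `x`; on the left
they are sorted by their kernels. -/
theorem sum_scaledDescFactorial_numBlocks (x : DowlingLattice n G) (y : ℕ) :
    ∑ z : DowlingLattice n G with x ≤ z, scaledDescFactorial (Nat.card G) (numBlocks z) y =
      (1 + (Nat.card G : ℤ) * y) ^ numBlocks x := by
  have := Fintype.ofFinite G
  let κ : (Fin n → Option (Fin y × G)) → DowlingLattice n G :=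
    fun f => toAntisymmetrization (· ≤ ·) (ker f)
  have hfiber : ∀ z : DowlingLattice n G,
      ((Finset.univ.filter fun f => κ f = z).card : ℤ) =
        scaledDescFactorial (Nat.card G) (numBlocks z) y := by
    intro z
    induction z using Quotient.inductionOn with
    | h P =>
      have h1 : ∀ f, κ f = Quotient.mk _ P ↔ P ≤ ker f ∧ ker f ≤ P := fun f =>
        (Quotient.eq (r := AntisymmRel.setoid _ _)).trans and_comm
      have h2 := card_antisymmRel_ker (J := Fin y) P
      rw [Nat.card_eq_fintype_card, Fintype.card_subtype] at h2
      simp only [h1, h2, Fintype.card_fin]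
      push_cast
      rfl
  have hupper : ((Finset.univ.filter fun f => x ≤ κ f).card : ℤ) =
      (1 + (Nat.card G : ℤ) * y) ^ numBlocks x := by
    obtain ⟨P, rfl⟩ : ∃ P, toAntisymmetrization (· ≤ ·) P = x := Quotient.exists_rep x
    have h1 : ∀ f, toAntisymmetrization (· ≤ ·) P ≤ κ f ↔ P ≤ ker f := fun f =>
      toAntisymmetrization_le_toAntisymmetrization_iff
    have h2 := card_le_ker (J := Fin y) P
    rw [Nat.card_eq_fintype_card, Fintype.card_subtype] at h2
    simp only [h1, h2, Fintype.card_fin]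
    push_cast
    rfl
  rw [← hupper, Finset.card_eq_sum_card_fiberwise (f := κ)
    (t := Finset.univ.filter fun z : DowlingLattice n G => x ≤ z)
    (fun f hf => by simpa using hf)]
  push_cast
  refine Finset.sum_congr rfl fun z hz => ?_
  rw [← hfiber z, Finset.filter_filter]
  congr 2
  ext f
  have hz' := (Finset.mem_filter.1 hz).2
  simp only [Finset.mem_filter, Finset.mem_univ, true_and]
  constructor
  · rintro rfl
    exact ⟨hz', rfl⟩
  · exact fun h => h.2

open Classical in
theorem sum_range_card_upper_mul (x : DowlingLattice n G) {K : ℕ} (hK : n < K) (y : ℕ) :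
    ∑ t ∈ Finset.range K,
        ((Finset.univ.filter fun z => x ≤ z ∧ numBlocks z = t).card : ℤ) *
          scaledDescFactorial (Nat.card G) t y =
      (1 + (Nat.card G : ℤ) * y) ^ numBlocks x := by
  rw [← sum_scaledDescFactorial_numBlocks,
    ← Finset.sum_fiberwise_of_maps_to (g := numBlocks) (t := Finset.range K)
      fun z _ => Finset.mem_range.2 ((numBlocks_le z).trans_lt hK)]
  refine Finset.sum_congr rfl fun t _ => ?_
  rw [Finset.filter_filter, ← nsmul_eq_mul, ← Finset.sum_const]
  exact Finset.sum_congr rfl fun z hz => by rw [(Finset.mem_filter.1 hz).2.2]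

/-! ### Whitney numbers and their convolutions -/

variable (G)

theorem whitneyFirst_eq_sum (n k : ℕ) : whitneyFirst G n k =
    ∑ x : DowlingLattice n G with numBlocks x = k, IncidenceAlgebra.mu ℤ ⊥ x := by
  simp only [whitneyFirst, rank_eq_iff]

theorem whitneySecond_eq_card (n k : ℕ) : whitneySecond G n k =
    ((Finset.univ.filter fun x : DowlingLattice n G => numBlocks x = k).card : ℤ) := by
  simp [whitneySecond, rank_eq_iff]

theorem whitneySecond_eq_zero {n k : ℕ} (h : n < k) : whitneySecond G n k = 0 := by
  rw [whitneySecond_eq_card, Nat.cast_eq_zero, Finset.card_eq_zero, Finset.filter_eq_empty_iff]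
  exact fun x _ hx => ((numBlocks_le x).trans_lt h).ne hx

/-- The Whitney numbers of the second kind are the coefficients of `(1 + m y) ^ n` in the basis
`∏ i < t, (m * y - m * i)`. -/
theorem sum_range_whitneySecond_mul {n K : ℕ} (hK : n < K) (y : ℕ) :
    ∑ t ∈ Finset.range K, whitneySecond G n t * scaledDescFactorial (Nat.card G) t y =
      (1 + (Nat.card G : ℤ) * y) ^ n := by
  have h := sum_range_card_upper_mul (⊥ : DowlingLattice n G) hK y
  rw [numBlocks_bot] at h
  rw [← h]
  refine Finset.sum_congr rfl fun t _ => ?_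
  rw [whitneySecond_eq_card]
  congr 3
  ext z
  simp

/-- The number of elements with `t` blocks above `x` depends only on the number of blocks of `x`, as
if the interval above `x` were a Dowling lattice of rank `numBlocks x`. -/
theorem card_upper_eq_whitneySecond {G : Type*} [Group G] [Finite G] {n : ℕ}
    (x : DowlingLattice n G) (t : ℕ) [DecidablePred fun z => x ≤ z ∧ numBlocks z = t] :
    ((Finset.univ.filter fun z => x ≤ z ∧ numBlocks z = t).card : ℤ) =
      whitneySecond G (numBlocks x) t := by
  classical
  have h := eq_of_sum_mul_scaledDescFactorial_eq (K := n + t + 1) (t := t)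
    (a := fun t => ((Finset.univ.filter fun z => x ≤ z ∧ numBlocks z = t).card : ℤ))
    (b := whitneySecond G (numBlocks x)) (Nat.card_pos (α := G))
    (fun y => (sum_range_card_upper_mul x (by omega) y).trans
      (sum_range_whitneySecond_mul G (by have := numBlocks_le x; omega) y).symm) (by omega)
  rw [← h]
  congr!

theorem whitneySecond_succ (n t : ℕ) : whitneySecond G (n + 1) t =
    (if t = 0 then 0 else whitneySecond G n (t - 1)) +
      (1 + (t : ℤ) * Nat.card G) * whitneySecond G n t := by
  refine eq_of_sum_mul_scaledDescFactorial_eq (K := n + t + 2) (t := t)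
    (a := whitneySecond G (n + 1))
    (b := fun t => (if t = 0 then 0 else whitneySecond G n (t - 1)) +
      (1 + (t : ℤ) * Nat.card G) * whitneySecond G n t) (Nat.card_pos (α := G))
    (fun y => ?_) (by omega)
  rw [sum_range_whitneySecond_mul G (by omega), pow_succ,
    ← sum_range_whitneySecond_mul G (K := n + t + 2) (by omega), Finset.sum_mul]
  simp only [add_mul (ite _ _ _), Finset.sum_add_distrib]
  rw [Finset.sum_range_succ' (fun i => (if i = 0 then 0 else whitneySecond G n (i - 1)) * _)]
  have hlast : ∑ i ∈ Finset.range (n + t + 1),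
      whitneySecond G n i * scaledDescFactorial (Nat.card G) (i + 1) y =
        ∑ i ∈ Finset.range (n + t + 2),
          whitneySecond G n i * scaledDescFactorial (Nat.card G) (i + 1) y := by
    rw [Finset.sum_range_succ _ (n + t + 1), whitneySecond_eq_zero G (by omega : n < n + t + 1),
      zero_mul, add_zero]
  simp only [Nat.add_eq_zero_iff, one_ne_zero, and_false, if_false, Nat.add_sub_cancel, if_true,
    zero_mul, add_zero, hlast]
  rw [← Finset.sum_add_distrib]
  refine Finset.sum_congr rfl fun i _ => ?_
  rw [scaledDescFactorial_succ]
  ring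

/-- The matrices of Whitney numbers of the two kinds are inverse to each other. -/
theorem finsum_whitneyFirst_mul_whitneySecond (n t : ℕ) :
    ∑ᶠ k : ℕ, whitneyFirst G n k * whitneySecond G k t = if n = t then 1 else 0 := by
  classical
  rw [finsum_whitneyFirst_mul]
  have h1 : ∑ k ∈ Finset.range (n + 1), whitneyFirst G n k * whitneySecond G k t =
      ∑ x : DowlingLattice n G,
        IncidenceAlgebra.mu ℤ ⊥ x * whitneySecond G (numBlocks x) t := by
    rw [← Finset.sum_fiberwise_of_maps_to (g := numBlocks) (t := Finset.range (n + 1))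
      fun x _ => Finset.mem_range.2 (Nat.lt_succ_of_le (numBlocks_le x))]
    refine Finset.sum_congr rfl fun k _ => ?_
    rw [whitneyFirst_eq_sum, Finset.sum_mul]
    exact Finset.sum_congr rfl fun x hx => by rw [(Finset.mem_filter.1 hx).2]
  -- exchange the summation over `x` with that over the elements with `t` blocks above `x`
  have h2 : ∀ x : DowlingLattice n G, IncidenceAlgebra.mu ℤ ⊥ x * whitneySecond G (numBlocks x) t =
      ∑ z : DowlingLattice n G with numBlocks z = t,
        if x ≤ z then IncidenceAlgebra.mu ℤ ⊥ x else 0 := by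
    intro x
    rw [← card_upper_eq_whitneySecond, ← Finset.sum_filter, Finset.filter_filter, Finset.sum_const,
      nsmul_eq_mul, mul_comm]
    simp only [and_comm]
  have h3 : ∀ z : DowlingLattice n G,
      (∑ x : DowlingLattice n G, if x ≤ z then IncidenceAlgebra.mu ℤ ⊥ x else 0) =
        if ⊥ = z then 1 else 0 := by
    intro z
    rw [← IncidenceAlgebra.sum_Icc_mu_right, ← Finset.sum_filter]
    refine Finset.sum_congr ?_ fun _ _ => rfl
    ext x
    simp
  rw [h1, Finset.sum_congr rfl fun x _ => h2 x, Finset.sum_comm,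
    Finset.sum_congr rfl fun z _ => h3 z, Finset.sum_ite_eq]
  simp [numBlocks_bot]

theorem shiftedConvolution_zero (n t : ℕ) :
    shiftedConvolution G n t 0 = if n = t then 1 else 0 :=
  finsum_whitneyFirst_mul_whitneySecond G n t

theorem shiftedConvolution_succ (n t s : ℕ) : shiftedConvolution G n t (s + 1) =
    (if t = 0 then 0 else shiftedConvolution G n (t - 1) s) +
      (1 + (t : ℤ) * Nat.card G) * shiftedConvolution G n t s := by
  simp only [shiftedConvolution, finsum_whitneyFirst_mul, ← add_assoc, whitneySecond_succ]
  rcases eq_or_ne t 0 with rfl | ht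
  · simp
  · simp only [if_neg ht, mul_add, Finset.sum_add_distrib, Finset.mul_sum]
    congr 1
    exact Finset.sum_congr rfl fun k _ => by ring

theorem shiftedConvolution_eq_zero {n t : ℕ} (h : t < n) (s : ℕ) :
    shiftedConvolution G n t s = 0 := by
  induction s generalizing t with
  | zero => rw [shiftedConvolution_zero, if_neg h.ne']
  | succ s ih =>
    rw [shiftedConvolution_succ, ih h, ih (t := t - 1) (by omega)]
    simp

end Counting

/-! ### Generating functions -/

section GeneratingFunction

variable (G : Type*) [Group G] [Finite G]

/-- The generating function of the shifted convolution in its second argument. -/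
noncomputable def convolutionSeries (n t : ℕ) : PowerSeries ℚ :=
  PowerSeries.mk fun s : ℕ => (shiftedConvolution G n t s : ℚ)

theorem convolutionSeries_mul (n t : ℕ) :
    convolutionSeries G n t *
        (1 - (1 + (t : PowerSeries ℚ) * (Nat.card G : PowerSeries ℚ)) * PowerSeries.X) =
      (if t = 0 then 0 else PowerSeries.X * convolutionSeries G n (t - 1)) +
        if n = t then 1 else 0 := by
  have hC : (1 + (t : PowerSeries ℚ) * (Nat.card G : PowerSeries ℚ)) =
      PowerSeries.C (1 + (t : ℚ) * (Nat.card G : ℚ)) := by simp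
  rw [hC, mul_sub, mul_one, mul_left_comm]
  ext s
  rcases s with _ | s
  · rw [map_sub, PowerSeries.coeff_C_mul, PowerSeries.coeff_zero_mul_X]
    split_ifs <;> simp_all [convolutionSeries, shiftedConvolution_zero]
  · rw [map_sub, PowerSeries.coeff_C_mul, PowerSeries.coeff_succ_mul_X]
    simp only [convolutionSeries, PowerSeries.coeff_mk, shiftedConvolution_succ]
    split_ifs <;> simp [PowerSeries.coeff_one, PowerSeries.coeff_succ_X_mul]

theorem coe_convolutionSeries {n t : ℕ} (h : n ≤ t) :
    ((convolutionSeries G n t : PowerSeries ℚ) : LaurentSeries ℚ) =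
      (1 / ((PowerSeries.X : PowerSeries ℚ) : LaurentSeries ℚ)) *
        ∏ j ∈ Finset.Icc n t,
          ((PowerSeries.X : PowerSeries ℚ) : LaurentSeries ℚ) /
            (1 - (1 + (j : LaurentSeries ℚ) * (Nat.card G : LaurentSeries ℚ)) *
              ((PowerSeries.X : PowerSeries ℚ) : LaurentSeries ℚ)) := by
  have hX : ((PowerSeries.X : PowerSeries ℚ) : LaurentSeries ℚ) ≠ 0 := by
    simp
  have hcoe : ∀ j : ℕ, ((1 - (1 + (j : PowerSeries ℚ) * (Nat.card G : PowerSeries ℚ)) *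
      PowerSeries.X : PowerSeries ℚ) : LaurentSeries ℚ) =
        1 - (1 + (j : LaurentSeries ℚ) * (Nat.card G : LaurentSeries ℚ)) *
          ((PowerSeries.X : PowerSeries ℚ) : LaurentSeries ℚ) := by
    intro j
    simp only [map_sub, map_mul, map_one, map_add, map_natCast]
  have hne : ∀ j : ℕ, 1 - (1 + (j : LaurentSeries ℚ) * (Nat.card G : LaurentSeries ℚ)) *
      ((PowerSeries.X : PowerSeries ℚ) : LaurentSeries ℚ) ≠ 0 := by
    intro j hj
    rw [← hcoe, ← PowerSeries.coe_zero] at hj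
    have h0 := congrArg PowerSeries.constantCoeff (HahnSeries.ofPowerSeries_injective hj)
    simp at h0
  have hrec := fun t => congrArg (HahnSeries.ofPowerSeries ℤ ℚ) (convolutionSeries_mul G n t)
  have hprev : n = 0 ∨ convolutionSeries G n (n - 1) = 0 := by
    rcases Nat.eq_zero_or_pos n with h0 | h0
    · exact Or.inl h0
    · refine Or.inr (PowerSeries.ext fun s => ?_)
      simp [convolutionSeries, shiftedConvolution_eq_zero G (Nat.sub_lt h0 one_pos)]
  induction t, h using Nat.le_induction with
  | base =>
    have h1 := hrec n
    rw [map_mul, hcoe] at h1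
    rw [Finset.Icc_self, Finset.prod_singleton, one_div, ← mul_div_assoc, inv_mul_cancel₀ hX,
      eq_div_iff (hne n), h1]
    rcases hprev with h0 | h0 <;> simp [h0]
  | succ t ht ih =>
    have h1 := hrec (t + 1)
    rw [map_mul, hcoe, if_neg t.succ_ne_zero, if_neg (by omega), add_zero, Nat.add_sub_cancel,
      map_mul, ih] at h1
    rw [Finset.prod_Icc_succ_top (by omega), ← mul_assoc, ← mul_div_assoc, eq_div_iff (hne _), h1,
      mul_comm]

end GeneratingFunction

end Dowling

theorem mainTheorem4 (G : Type*) [Group G] [Finite G] (n t : ℕ) (hn : 0 < n) :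
    (t < n → ∀ s : ℕ, Dowling.shiftedConvolution G n t s = 0) ∧
    (n ≤ t →
      ((PowerSeries.mk fun s : ℕ => (Dowling.shiftedConvolution G n t s : ℚ) :
          PowerSeries ℚ) : LaurentSeries ℚ) =
        (1 / ((PowerSeries.X : PowerSeries ℚ) : LaurentSeries ℚ)) *
          ∏ j ∈ Finset.Icc n t,
            ((PowerSeries.X : PowerSeries ℚ) : LaurentSeries ℚ) /
              (1 - (1 + (j : LaurentSeries ℚ) * (Nat.card G : LaurentSeries ℚ)) *
                ((PowerSeries.X : PowerSeries ℚ) : LaurentSeries ℚ))) ∧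
    (∑ᶠ k : ℕ, Dowling.whitneyFirst G n k * Dowling.whitneySecond G k t) =
      if n = t then 1 else 0 :=
  ⟨fun h s => Dowling.shiftedConvolution_eq_zero G h s,
    fun h => Dowling.coe_convolutionSeries G h,
    Dowling.finsum_whitneyFirst_mul_whitneySecond G n t⟩
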